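/- Let $M$ be a finitely presented monoid (that is, $M\cong \mathrm{Mon}\langle X\mid R\rangle$ with $X$ and $R$ finite) which is finite-$\mathcal J$-above: for every $v\in M$ the set of factors of $v$, i.e. of all $u\in M$ such that $v=xuy$ for some $x,y\in M$, is finite. Let $A$ be a finite alphabet, let $\varphi\colon A^*\to M$ be a monoid homomorphism, and let $L\subseteq A^*$ be a language such that the following problem is decidable: given a finite automaton over $A$ recognizing a rational language $R\subseteq A^*$, is $L\cap R$ empty? Then the membership problem for $\varphi(L)$ in $M$ is decidable: for every finite generating set $B$ of $M$, with canonical surjection $\pi\colon B^*\to M$, there is an algorithm which, given a word $w\in B^*$, decides whether $\pi(w)\in\varphi(L)$. -/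

import Mathlib

/-- `u` is a factor of `v` if `v = x * u * y` for some `x, y`. -/
def IsFactor {M : Type*} [Monoid M] (u v : M) : Prop :=
  ∃ x y : M, v = x * u * y

/-- A monoid is finite-J-above if every element has only finitely many factors. -/
def IsFiniteJAbove (M : Type*) [Monoid M] : Prop :=
  ∀ v : M, {u : M | IsFactor u v}.Finite

/-- A monoid is finitely presented if it is isomorphic to `Mon⟨X | R⟩` for some finite alphabet `X`
and some finite set `R` of pairs of words over `X`. -/
def IsFinitelyPresentedMonoid (M : Type*) [Monoid M] : Prop :=
  ∃ (n : ℕ) (R : Set (FreeMonoid (Fin n) × FreeMonoid (Fin n))), R.Finite ∧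
    Nonempty (M ≃* PresentedMonoid fun u v => (u, v) ∈ R)

/-- A finite (nondeterministic) automaton over `A`, as finite data that can be given to an
algorithm: a tuple `(n, I, T, E)`, where the set of states is `{0, …, n - 1}`, `I` lists the initial
states, `T` lists the terminal states and `E` lists the transitions. Entries that mention a number
`≥ n` are ignored, so that every tuple is a finite automaton. -/
abbrev FiniteAutomaton (A : Type*) : Type _ :=
  ℕ × List ℕ × List ℕ × List (ℕ × A × ℕ)

namespace FiniteAutomaton

variable {A : Type*}

/-- The automaton described by the tuple `(n, I, T, E)`. -/
def toNFA : (C : FiniteAutomaton A) → NFA A (Fin C.1)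
  | (_, I, T, E) =>
    { step := fun p a => {q | ((p : ℕ), a, (q : ℕ)) ∈ E}
      start := {q | (q : ℕ) ∈ I}
      accept := {q | (q : ℕ) ∈ T} }

/-- The rational language recognized by a finite automaton. -/
def language (C : FiniteAutomaton A) : Language A :=
  (toNFA C).accepts

end FiniteAutomaton

/-- There is an algorithm which, given a finite automaton `C` over `A`, decides whether
`L ∩ L(C)` is empty. -/
def RationalIntersectionEmptinessDecidable {A : Type*} [Primcodable A] (L : Language A) : Prop :=
  ComputablePred fun C : FiniteAutomaton A => L ⊓ FiniteAutomaton.language C = ⊥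

/-- The membership problem for the subset `S` of the finitely generated monoid `M` is decidable:
for every finite generating family of `M`, given by a surjective homomorphism `π` from a free
monoid of finite rank, there is an algorithm which, given a word `w` in the generators, decides
whether the element `π w` that it represents is in `S`. -/
def MembershipProblemDecidable {M : Type*} [Monoid M] (S : Set M) : Prop :=
  ∀ (n : ℕ) (π : FreeMonoid (Fin n) →* M), Function.Surjective π →
    ComputablePred fun w : List (Fin n) => π (FreeMonoid.ofList w) ∈ S

/-!
Both membership in `φ(L)` and non-membership turn out to be recursively enumerable, so membership is
decidable by Post's theorem. Fix a finite presentation of `M`; words over `A` and over the given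
generators are translated letter by letter into words over the generators of the presentation.

*Membership.* The element `π w` lies in `φ(L)` if and only if some word `l ∈ L` and some derivation
from the defining relations witness `φ l = π w`. Such a pair can be checked: `L` is decidable,
because `l ∈ L` says that `L` meets the rational language `{l}`
(`RationalIntersectionEmptinessDecidable.computablePred_mem`), and a derivation is a list of
rewriting instructions that is simply carried out (`reflTransGen_rewritesTo_iff`,
`IsFinitelyPresentedMonoid.exists_rules`).

*Non-membership.* Put `v = π w`. Identifying all elements of `M` that do not divide `v` on the left
gives a right congruence on `M`. It has finitely many classes, because `v` has finitely many factors,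
and the class of `v` is `{v}` (`IsFiniteJAbove.exists_separating`). Hence `v ∉ φ(L)` if and only if
`M` acts on the right on some finite set with a point `i` such that `i · v ≠ i · φ(l)` for all
`l ∈ L`. A finite action of the generators, given as a table, can be checked against the finitely
many relations (`primrecPred_tableRespects`), and `{l | i · φ(l) = i · v}` is recognized by a finite
automaton computed from the table and from `w`. So the remaining condition on the table, that this
rational language is disjoint from `L`, is decidable by hypothesis. It is not necessary to recognize
which tables come from the right congruence above: every table that passes the check is a proof
that `v ∉ φ(L)`.
-/

/-! ### Computable predicates -/

/-- Projections of computable predicates are recursively enumerable, by unbounded search. -/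
theorem ComputablePred.rePred_exists {α β : Type*} [Primcodable α] [Primcodable β]
    {P : α × β → Prop} (hP : ComputablePred P) : REPred fun a => ∃ b, P (a, b) := by
  obtain ⟨f, hf, rfl⟩ := ComputablePred.computable_iff.1 hP
  have hg : Computable₂ fun (a : α) (n : ℕ) =>
      (Encodable.decode (α := β) n).bind fun b => bif f (a, b) then some () else none := by
    refine Computable.option_bind (Computable.decode.comp Computable.snd) ?_
    exact Computable.cond
      (hf.comp ((Computable.fst.comp Computable.fst).pair Computable.snd))
      (Computable.const _) (Computable.const _)
  refine (Partrec.rfindOpt hg).dom_re.of_eq fun a => ?_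
  rw [Nat.rfindOpt_dom]
  constructor
  · rintro ⟨n, u, h⟩
    obtain ⟨b, -, hb⟩ := Option.bind_eq_some_iff.1 h
    refine ⟨b, ?_⟩
    by_contra hne
    simp [Bool.eq_false_iff.2 hne] at hb
  · rintro ⟨b, hb⟩
    refine ⟨Encodable.encode b, (), ?_⟩
    simp [show f (a, b) = true from hb]

theorem ComputablePred.comp_computable {α β : Type*} [Primcodable α] [Primcodable β] {P : β → Prop}
    {f : α → β} (hP : ComputablePred P) (hf : Computable f) : ComputablePred fun a => P (f a) := by
  obtain ⟨g, hg, rfl⟩ := ComputablePred.computable_iff.1 hP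
  exact ComputablePred.computable_iff.2 ⟨_, hg.comp hf, rfl⟩

theorem ComputablePred.and_computable {α : Type*} [Primcodable α] {P Q : α → Prop}
    (hP : ComputablePred P) (hQ : ComputablePred Q) : ComputablePred fun a => P a ∧ Q a := by
  obtain ⟨f, hf, rfl⟩ := ComputablePred.computable_iff.1 hP
  obtain ⟨g, hg, rfl⟩ := ComputablePred.computable_iff.1 hQ
  refine ComputablePred.computable_iff.2 ⟨_, Primrec.and.to_comp.comp hf hg, ?_⟩
  ext a
  simp

/-! ### Deterministic automata as finite data -/

namespace FiniteAutomaton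

variable {A : Type*}

/-- The deterministic automaton with states `0, …, k - 1`, transition function `δ`, initial state
`i` and the single terminal state `t`. The finite alphabet is given as a list of its letters. -/
def ofStep (letters : List A) (k : ℕ) (δ : ℕ → A → ℕ) (i t : ℕ) : FiniteAutomaton A :=
  (k, [i], [t], (List.range k).flatMap fun p => letters.map fun a => (p, a, δ p a))

/-- An automaton whose transitions are the graph of a function `δ` accepts the words along which
`δ` leads from the initial to the terminal state. -/
theorem mem_accepts_of_step_eq {k : ℕ} {N : NFA A (Fin k)} {δ : ℕ → A → ℕ} {i t : ℕ}
    (hstep : ∀ p a q, q ∈ N.step p a ↔ δ p a = q) (hstart : ∀ q, q ∈ N.start ↔ (q : ℕ) = i)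
    (haccept : ∀ q, q ∈ N.accept ↔ (q : ℕ) = t) (hδ : ∀ p < k, ∀ a, δ p a < k) (hi : i < k)
    (l : List A) : l ∈ N.accepts ↔ l.foldl δ i = t := by
  have key : ∀ (l : List A) (i : ℕ), i < k →
      l.foldl δ i < k ∧ N.evalFrom {q | (q : ℕ) = i} l = {q : Fin k | (q : ℕ) = l.foldl δ i} := by
    intro l
    induction l with
    | nil => exact fun i hi => ⟨hi, rfl⟩
    | cons a l ih =>
      intro i hi
      have h : N.stepSet {q | (q : ℕ) = i} a = {q : Fin k | (q : ℕ) = δ i a} := by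
        ext q
        rw [NFA.mem_stepSet]
        constructor
        · rintro ⟨p, rfl, h⟩
          exact ((hstep _ _ _).1 h).symm
        · exact fun h => ⟨⟨i, hi⟩, rfl, (hstep _ _ _).2 h.symm⟩
      rw [NFA.evalFrom_cons, h]
      exact ih (δ i a) (hδ i hi a)
  obtain ⟨hlt, heq⟩ := key l i hi
  rw [NFA.mem_accepts, show N.start = {q : Fin k | (q : ℕ) = i} from Set.ext hstart, heq]
  constructor
  · rintro ⟨q, hq, h⟩
    exact h.symm.trans ((haccept q).1 hq)
  · exact fun h => ⟨⟨_, hlt⟩, (haccept _).2 h, rfl⟩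

theorem mem_language_ofStep {letters : List A} (hletters : ∀ a, a ∈ letters) {k : ℕ}
    {δ : ℕ → A → ℕ} (hδ : ∀ p < k, ∀ a, δ p a < k) {i : ℕ} (hi : i < k) (t : ℕ) (l : List A) :
    l ∈ language (ofStep letters k δ i t) ↔ l.foldl δ i = t := by
  refine mem_accepts_of_step_eq (k := k) (fun p a q => ?_) (fun q => ?_) (fun q => ?_) hδ hi l
  · change ((p : ℕ), a, (q : ℕ)) ∈ List.flatMap _ _ ↔ _
    simp only [List.mem_flatMap, List.mem_range, List.mem_map, Prod.mk.injEq]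
    constructor
    · rintro ⟨_, -, _, -, rfl, rfl, h⟩
      exact h
    · exact fun h => ⟨p, p.isLt, a, hletters a, rfl, rfl, h⟩
  · exact List.mem_singleton
  · exact List.mem_singleton

theorem primrec_ofStep [Primcodable A] {C : Type*} [Primcodable C] (letters : List A)
    {k i t : C → ℕ} {δ : C → ℕ → A → ℕ} (hk : Primrec k)
    (hδ : Primrec fun x : C × ℕ × A => δ x.1 x.2.1 x.2.2) (hi : Primrec i) (ht : Primrec t) :
    Primrec fun c => ofStep letters (k c) (δ c) (i c) (t c) := by
  have hsingle : Primrec fun n : ℕ => [n] :=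
    Primrec.list_cons.comp Primrec.id (Primrec.const [])
  refine hk.pair ((hsingle.comp hi).pair ((hsingle.comp ht).pair ?_))
  refine Primrec.list_flatMap (Primrec.list_range.comp hk) ?_
  refine Primrec.list_map (Primrec.const letters) ?_
  have h : Primrec fun x : (C × ℕ) × A => (x.1.1, x.1.2, x.2) :=
    (Primrec.fst.comp Primrec.fst).pair ((Primrec.snd.comp Primrec.fst).pair Primrec.snd)
  exact (Primrec.snd.comp Primrec.fst).pair (Primrec.snd.pair (hδ.comp h))

end FiniteAutomaton

/-! ### Decidability of the language -/

/-- The transition function of the automaton that recognizes only the word `l`: the state `p` means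
that the first `p` letters of `l` have been read, and the state `l.length + 1` is a sink. -/
def singletonStep {A : Type*} [DecidableEq A] (l : List A) (p : ℕ) (a : A) : ℕ :=
  if l[p]? = some a then p + 1 else l.length + 1

theorem singletonStep_lt {A : Type*} [DecidableEq A] (l : List A) (p : ℕ) (a : A) :
    singletonStep l p a < l.length + 2 := by
  unfold singletonStep
  split_ifs with h
  · have := (List.getElem?_eq_some_iff.1 h).1
    omega
  · omega

theorem foldl_singletonStep_eq_length_iff {A : Type*} [DecidableEq A] (l w : List A) :
    w.foldl (singletonStep l) 0 = l.length ↔ w = l := by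
  have sink : ∀ w : List A, w.foldl (singletonStep l) (l.length + 1) = l.length + 1 := by
    intro w
    induction w with
    | nil => rfl
    | cons a w ih => simpa [singletonStep] using ih
  have key : ∀ (w : List A) (p : ℕ), p ≤ l.length →
      (w.foldl (singletonStep l) p = l.length ↔ w = l.drop p) := by
    intro w
    induction w with
    | nil =>
      intro p hp
      rw [List.foldl_nil, eq_comm (a := []), List.drop_eq_nil_iff]
      omega
    | cons a w ih =>
      intro p hp
      rw [List.foldl_cons]
      by_cases h : l[p]? = some a
      · obtain ⟨hlt, ha⟩ := List.getElem?_eq_some_iff.1 h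
        rw [singletonStep, if_pos h, ih _ hlt, List.drop_eq_getElem_cons hlt, ha]
        simp
      · rw [singletonStep, if_neg h, sink]
        refine iff_of_false (by omega) fun hw => h ?_
        have := congrArg (fun s => s[0]?) hw
        simpa using this.symm
  simpa using key w 0 (Nat.zero_le _)

theorem primrec_singletonStep {A : Type*} [Primcodable A] [DecidableEq A] :
    Primrec fun x : List A × ℕ × A => singletonStep x.1 x.2.1 x.2.2 := by
  unfold singletonStep
  refine Primrec.ite (Primrec.eq.comp ?_ ?_) ?_ ?_
  · exact Primrec.list_getElem?.comp Primrec.fst (Primrec.fst.comp Primrec.snd)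
  · exact Primrec.option_some.comp (Primrec.snd.comp Primrec.snd)
  · exact Primrec.succ.comp (Primrec.fst.comp Primrec.snd)
  · exact Primrec.succ.comp (Primrec.list_length.comp Primrec.fst)

/-- Membership of `l` in `L` is the question whether `L` meets the rational language `{l}`. -/
theorem RationalIntersectionEmptinessDecidable.computablePred_mem {A : Type*} [Finite A]
    [Primcodable A] {L : Language A} (hL : RationalIntersectionEmptinessDecidable L) :
    ComputablePred fun l : List A => l ∈ L := by
  classical
  have := Fintype.ofFinite A
  have hcomp : Primrec fun l : List A =>
      FiniteAutomaton.ofStep Finset.univ.toList (l.length + 2) (singletonStep l) 0 l.length :=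
    FiniteAutomaton.primrec_ofStep _
      (Primrec.succ.comp (Primrec.succ.comp Primrec.list_length)) primrec_singletonStep
      (Primrec.const 0) Primrec.list_length
  refine (ComputablePred.comp_computable hL hcomp.to_comp).not.of_eq fun l => ?_
  rw [← not_iff_not, not_not, eq_bot_iff]
  have hmem := FiniteAutomaton.mem_language_ofStep (A := A) (letters := Finset.univ.toList)
    (by simp) (fun p _ a => singletonStep_lt l p a) (Nat.succ_pos _) l.length
  constructor
  · intro h hl
    exact h ⟨hl, (hmem l).2 ((foldl_singletonStep_eq_length_iff l l).2 rfl)⟩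
  · rintro hl w ⟨hw, hw'⟩
    rw [(foldl_singletonStep_eq_length_iff l w).1 ((hmem w).1 hw')] at hw
    exact hl hw

/-! ### Derivations in finite presentations -/

section Rewriting

variable {X : Type*}

/-- One rewriting step: a factor of `u` that is the left-hand side of a rule is replaced by the
right-hand side of that rule. -/
def RewritesTo (rules : List (List X × List X)) (u v : List X) : Prop :=
  ∃ x y : List X, ∃ r ∈ rules, u = x ++ r.1 ++ y ∧ v = x ++ r.2 ++ y

/-- Carries out the rewriting instruction `(x, j, y)`: the word `x ++ lhs ++ y` becomes
`x ++ rhs ++ y`, where `(lhs, rhs)` is the `j`-th rule, and every other word stays as it is. -/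
def applyInstruction [DecidableEq X] (rules : List (List X × List X)) (u : List X)
    (s : List X × Fin rules.length × List X) : List X :=
  if u = s.1 ++ (rules.get s.2.1).1 ++ s.2.2 then s.1 ++ (rules.get s.2.1).2 ++ s.2.2 else u

theorem reflTransGen_rewritesTo_iff [DecidableEq X] (rules : List (List X × List X))
    (u v : List X) :
    Relation.ReflTransGen (RewritesTo rules) u v ↔
      ∃ s : List (List X × Fin rules.length × List X),
        s.foldl (applyInstruction rules) u = v := by
  constructor
  · intro h
    induction h with
    | refl => exact ⟨[], rfl⟩
    | tail _ h ih =>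
      obtain ⟨s, rfl⟩ := ih
      obtain ⟨x, y, r, hr, h, rfl⟩ := h
      obtain ⟨j, rfl⟩ := List.get_of_mem hr
      refine ⟨s ++ [(x, j, y)], ?_⟩
      rw [List.foldl_append, h]
      simp [applyInstruction]
  · rintro ⟨s, rfl⟩
    induction s generalizing u with
    | nil => exact .refl
    | cons a s ih =>
      refine .trans ?_ (ih _)
      unfold applyInstruction
      split_ifs with h
      · exact .single ⟨_, _, _, List.get_mem _ _, h, rfl⟩
      · exact .refl

theorem primrec_applyInstruction [Primcodable X] [DecidableEq X]
    (rules : List (List X × List X)) : Primrec₂ (applyInstruction rules) := by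
  have hrule : Primrec rules.get := Primrec.dom_finite _
  have hj : Primrec fun x : List X × List X × Fin rules.length × List X => rules.get x.2.2.1 :=
    hrule.comp (Primrec.fst.comp (Primrec.snd.comp Primrec.snd))
  have hx : Primrec fun x : List X × List X × Fin rules.length × List X => x.2.1 :=
    Primrec.fst.comp Primrec.snd
  have hy : Primrec fun x : List X × List X × Fin rules.length × List X => x.2.2.2 :=
    Primrec.snd.comp (Primrec.snd.comp Primrec.snd)
  refine Primrec.ite (Primrec.eq.comp Primrec.fst ?_) ?_ Primrec.fst
  · exact Primrec.list_append.comp (Primrec.list_append.comp hx (Primrec.fst.comp hj)) hy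
  · exact Primrec.list_append.comp (Primrec.list_append.comp hx (Primrec.snd.comp hj)) hy

/-- The congruence generated by `R` is the reflexive transitive closure of rewriting by the rules
in `R`, used in both directions. -/
theorem conGen_iff_reflTransGen_rewritesTo {R : Set (FreeMonoid X × FreeMonoid X)}
    {rules : List (List X × List X)}
    (hrules : ∀ r, r ∈ rules ↔ (FreeMonoid.ofList r.1, FreeMonoid.ofList r.2) ∈ R ∨
      (FreeMonoid.ofList r.2, FreeMonoid.ofList r.1) ∈ R) (u v : FreeMonoid X) :
    conGen (fun u v => (u, v) ∈ R) u v ↔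
      Relation.ReflTransGen (RewritesTo rules) u.toList v.toList := by
  constructor
  · intro h
    change ConGen.Rel (fun u v => (u, v) ∈ R) u v at h
    induction h with
    | of x y h => exact .single ⟨[], [], (x.toList, y.toList), (hrules _).2 (.inl h), by simp⟩
    | refl x => exact .refl
    | symm _ ih =>
      have hsymm : Std.Symm (RewritesTo rules) := by
        refine ⟨?_⟩
        rintro _ _ ⟨x, y, r, hr, rfl, rfl⟩
        exact ⟨x, y, r.swap, (hrules _).2 ((hrules _).1 hr).symm, rfl, rfl⟩
      exact Std.Symm.symm _ _ ih
    | trans _ _ ih₁ ih₂ => exact ih₁.trans ih₂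
    | @mul w x y z _ _ ih₁ ih₂ =>
      have h₁ : Relation.ReflTransGen (RewritesTo rules) (w.toList ++ y.toList)
          (x.toList ++ y.toList) := by
        refine ih₁.lift (· ++ y.toList) ?_
        rintro _ _ ⟨a, b, r, hr, rfl, rfl⟩
        exact ⟨a, b ++ y.toList, r, hr, by simp, by simp⟩
      have h₂ : Relation.ReflTransGen (RewritesTo rules) (x.toList ++ y.toList)
          (x.toList ++ z.toList) := by
        refine ih₂.lift (x.toList ++ ·) ?_
        rintro _ _ ⟨a, b, r, hr, rfl, rfl⟩
        exact ⟨x.toList ++ a, b, r, hr, by simp, by simp⟩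
      exact h₁.trans h₂
  · intro h
    suffices ∀ u v : List X, Relation.ReflTransGen (RewritesTo rules) u v →
        conGen (fun u v => (u, v) ∈ R) (FreeMonoid.ofList u) (FreeMonoid.ofList v) from
      this _ _ h
    intro u v h
    induction h with
    | refl => exact (conGen _).refl _
    | tail _ h ih =>
      obtain ⟨x, y, r, hr, rfl, rfl⟩ := h
      refine (conGen _).trans ih ?_
      rw [FreeMonoid.ofList_append, FreeMonoid.ofList_append, FreeMonoid.ofList_append,
        FreeMonoid.ofList_append]
      refine (conGen _).mul ((conGen _).mul ((conGen _).refl _) ?_) ((conGen _).refl _)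
      rcases (hrules r).1 hr with h | h
      · exact .of _ _ h
      · exact (conGen _).symm (.of _ _ h)

end Rewriting

/-- A finitely presented monoid is given by generators and a finite rewriting system whose
derivations are exactly the equalities between words. -/
theorem IsFinitelyPresentedMonoid.exists_rules {M : Type*} [Monoid M]
    (hfp : IsFinitelyPresentedMonoid M) :
    ∃ (m : ℕ) (rules : List (List (Fin m) × List (Fin m))) (ρ : FreeMonoid (Fin m) →* M),
      Function.Surjective ρ ∧ ∀ u v : List (Fin m),
        ρ (FreeMonoid.ofList u) = ρ (FreeMonoid.ofList v) ↔
          Relation.ReflTransGen (RewritesTo rules) u v := by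
  obtain ⟨m, R, hR, ⟨e⟩⟩ := hfp
  have hfin := (hR.union (hR.image Prod.swap)).image
    (Prod.map FreeMonoid.toList FreeMonoid.toList)
  refine ⟨m, hfin.toFinset.toList,
    e.symm.toMonoidHom.comp (PresentedMonoid.mk fun u v => (u, v) ∈ R),
    e.symm.surjective.comp PresentedMonoid.surjective_mk, fun u v => ?_⟩
  have hrel := conGen_iff_reflTransGen_rewritesTo (R := R) (rules := hfin.toFinset.toList) ?_
    (FreeMonoid.ofList u) (FreeMonoid.ofList v)
  · rw [FreeMonoid.toList_ofList, FreeMonoid.toList_ofList] at hrel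
    rw [← hrel, ← PresentedMonoid.mk_eq_mk_iff]
    exact e.symm.injective.eq_iff
  · rintro ⟨a, b⟩
    rw [Finset.mem_toList, Set.Finite.mem_toFinset]
    constructor
    · rintro ⟨⟨x, y⟩, h | ⟨⟨x', y'⟩, h, h'⟩, h''⟩
      · cases h''
        exact .inl h
      · cases h'
        cases h''
        exact .inr h
    · rintro (h | h)
      · exact ⟨_, .inl h, rfl⟩
      · exact ⟨_, .inr ⟨_, h, rfl⟩, rfl⟩

/-- Words over the letters of one generating set are translated letter by letter into words over
another one. -/
theorem exists_translation {M X Y : Type*} [Monoid M] {ρ : FreeMonoid X →* M}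
    (hρ : Function.Surjective ρ) (ψ : FreeMonoid Y →* M) :
    ∃ τ : Y → List X, ∀ w : List Y,
      ρ (FreeMonoid.ofList (w.flatMap τ)) = ψ (FreeMonoid.ofList w) := by
  choose s hs using hρ
  refine ⟨fun y => (s (ψ (FreeMonoid.of y))).toList, fun w => ?_⟩
  induction w with
  | nil => simp
  | cons y w ih =>
    rw [List.flatMap_cons, FreeMonoid.ofList_append, map_mul, ih, FreeMonoid.ofList_cons, map_mul,
      FreeMonoid.ofList_toList, hs]

/-! ### Finite actions that separate an element -/

/-- The map `e` identifies all elements that do not divide `v` on the left and no others. As left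
divisors are factors, it takes finitely many values. -/
theorem IsFiniteJAbove.exists_separating {M : Type*} [Monoid M] (hJ : IsFiniteJAbove M) (v : M) :
    ∃ (k : ℕ) (e : M → Fin (k + 1)), Function.Surjective e ∧
      (∀ a b c, e a = e b → e (a * c) = e (b * c)) ∧ ∀ u, e u = e v → u = v := by
  classical
  -- The value `none` is the common class of the elements that are not left divisors of `v`.
  let f : M → Option M := fun u => if u ∣ v then some u else none
  have hfin : (Set.range f).Finite := by
    refine (((hJ v).image some).insert none).subset ?_
    rintro _ ⟨u, rfl⟩
    by_cases h : u ∣ v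
    · obtain ⟨y, hy⟩ := h
      exact .inr ⟨u, ⟨1, y, by simpa using hy⟩, by simp [f, hy]⟩
    · exact .inl (by simp [f, h])
  have := hfin.to_subtype
  have : Nonempty (Set.range f) := ⟨⟨f 1, 1, rfl⟩⟩
  obtain ⟨k, hk⟩ := Nat.exists_eq_succ_of_ne_zero (Nat.card_pos (α := Set.range f)).ne'
  let g := Finite.equivFinOfCardEq hk
  have hg : ∀ a b, g (Set.rangeFactorization f a) = g (Set.rangeFactorization f b) ↔ f a = f b := by
    intro a b
    rw [g.injective.eq_iff, Subtype.ext_iff]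
    rfl
  refine ⟨k, g ∘ Set.rangeFactorization f, g.surjective.comp Set.rangeFactorization_surjective,
    fun a b c h => ?_, fun u h => ?_⟩
  · have h := (hg a b).1 h
    refine (hg _ _).2 ?_
    by_cases ha : a ∣ v <;> by_cases hb : b ∣ v <;> simp only [f, ha, hb, if_true, if_false] at h
    · cases h
      rfl
    · cases h
    · cases h
    · have ha' : ¬ a * c ∣ v := fun h => ha ((Dvd.intro _ rfl).trans h)
      have hb' : ¬ b * c ∣ v := fun h => hb ((Dvd.intro _ rfl).trans h)
      simp [f, ha', hb']
  · have h := (hg u v).1 h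
    by_cases hu : u ∣ v <;> simp [f, hu] at h
    exact h

/-! ### Tables of finite actions -/

section Tables

variable {m : ℕ}

/-- A pair `(k, T)` encodes a right action of words over `Fin m` on `{0, …, k}`: the letter `x`
moves the state `p` to the entry `p` of the row `x` of `T`. Missing entries count as `0` and entries
are reduced modulo `k + 1`, so that every pair encodes an action. -/
def tableStep (c : ℕ × List (List ℕ)) (p : ℕ) (x : Fin m) : ℕ :=
  (c.2.getD x []).getD p 0 % (c.1 + 1)

/-- The action encoded by a table satisfies all the relations. -/
def TableRespects (rules : List (List (Fin m) × List (Fin m))) (c : ℕ × List (List ℕ)) : Prop :=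
  ∀ p < c.1 + 1, ∀ r ∈ rules, r.1.foldl (tableStep c) p = r.2.foldl (tableStep c) p

theorem foldl_tableStep_lt (c : ℕ × List (List ℕ)) {p : ℕ} (hp : p < c.1 + 1) (u : List (Fin m)) :
    u.foldl (tableStep c) p < c.1 + 1 := by
  induction u generalizing p with
  | nil => exact hp
  | cons x u ih => exact ih (Nat.mod_lt _ (Nat.succ_pos _))

/-- If the relations hold at every state, then so do all their consequences: the words act as the
elements that they represent. -/
theorem TableRespects.foldl_eq {rules : List (List (Fin m) × List (Fin m))}
    {c : ℕ × List (List ℕ)} (hc : TableRespects rules c) {u v : List (Fin m)}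
    (h : Relation.ReflTransGen (RewritesTo rules) u v) {p : ℕ} (hp : p < c.1 + 1) :
    u.foldl (tableStep c) p = v.foldl (tableStep c) p := by
  induction h with
  | refl => rfl
  | tail _ h ih =>
    obtain ⟨x, y, r, hr, rfl, rfl⟩ := h
    rw [ih]
    simp only [List.foldl_append]
    rw [hc _ (foldl_tableStep_lt c hp x) r hr]

theorem primrec_foldl_tableStep {C : Type*} [Primcodable C] {c : C → ℕ × List (List ℕ)}
    {p : C → ℕ} {u : C → List (Fin m)} (hc : Primrec c) (hp : Primrec p) (hu : Primrec u) :
    Primrec fun z => (u z).foldl (tableStep (c z)) (p z) := by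
  refine Primrec.list_foldl (h := fun z x => tableStep (c z) x.1 x.2) hu hp ?_
  have hc' : Primrec fun x : C × ℕ × Fin m => c x.1 := hc.comp Primrec.fst
  have hx : Primrec fun x : C × ℕ × Fin m => (x.2.2 : ℕ) :=
    Primrec.fin_val.comp (Primrec.snd.comp Primrec.snd)
  exact Primrec.nat_mod.comp
    ((Primrec.list_getD 0).comp ((Primrec.list_getD []).comp (Primrec.snd.comp hc') hx)
      (Primrec.fst.comp Primrec.snd))
    (Primrec.succ.comp (Primrec.fst.comp hc'))

theorem primrecPred_tableRespects (rules : List (List (Fin m) × List (Fin m))) :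
    PrimrecPred (TableRespects rules) := by
  have h : PrimrecRel fun (r : List (Fin m) × List (Fin m)) (z : ℕ × ℕ × List (List ℕ)) =>
      r.1.foldl (tableStep z.2) z.1 = r.2.foldl (tableStep z.2) z.1 := by
    have hc : Primrec fun x : (List (Fin m) × List (Fin m)) × ℕ × ℕ × List (List ℕ) => x.2.2 :=
      Primrec.snd.comp Primrec.snd
    have hp : Primrec fun x : (List (Fin m) × List (Fin m)) × ℕ × ℕ × List (List ℕ) => x.2.1 :=
      Primrec.fst.comp Primrec.snd
    exact Primrec.eq.comp
      (primrec_foldl_tableStep hc hp (Primrec.fst.comp Primrec.fst))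
      (primrec_foldl_tableStep hc hp (Primrec.snd.comp Primrec.fst))
  have h₁ : PrimrecRel fun (p : ℕ) (c : ℕ × List (List ℕ)) => ∀ r ∈ rules,
      r.1.foldl (tableStep c) p = r.2.foldl (tableStep c) p :=
    h.forall_mem_list.comp (Primrec.const rules) Primrec.id
  have h₂ : PrimrecPred fun c : ℕ × List (List ℕ) => ∀ p ∈ List.range (c.1 + 1), ∀ r ∈ rules,
      r.1.foldl (tableStep c) p = r.2.foldl (tableStep c) p :=
    h₁.forall_mem_list.comp (Primrec.list_range.comp (Primrec.succ.comp Primrec.fst)) Primrec.id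
  exact h₂.of_eq fun c => by simp only [List.mem_range, TableRespects]

/-- Every right-invariant partition of `M` into finitely many classes, given by the surjection `e`,
is the orbit of a point under the action encoded by some table. -/
theorem exists_table {M : Type*} [Monoid M] (ρ : FreeMonoid (Fin m) →* M) {k : ℕ}
    {e : M → Fin (k + 1)} (he : Function.Surjective e)
    (hmul : ∀ a b c, e a = e b → e (a * c) = e (b * c)) :
    ∃ T : List (List ℕ), ∀ (a : M) (u : List (Fin m)),
      u.foldl (tableStep (k, T)) (e a) = e (a * ρ (FreeMonoid.ofList u)) := by
  choose s hs using he
  refine ⟨List.ofFn fun x : Fin m => List.ofFn fun p : Fin (k + 1) =>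
    (e (s p * ρ (FreeMonoid.of x)) : ℕ), fun a u => ?_⟩
  induction u generalizing a with
  | nil => simp
  | cons x u ih =>
    rw [List.foldl_cons, FreeMonoid.ofList_cons, map_mul, ← mul_assoc, ← ih,
      ← hmul _ _ _ (hs (e a))]
    congr 1
    rw [tableStep, List.getD_eq_getElem?_getD, List.getD_eq_getElem?_getD, List.getElem?_ofFn,
      dif_pos x.isLt, Option.getD_some, List.getElem?_ofFn, dif_pos (e a).isLt, Option.getD_some]
    exact Nat.mod_eq_of_lt (Fin.isLt _)

end Tables

/-! ### Membership in the image of the language -/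

theorem theorem3p6 {M : Type*} [Monoid M] (hfp : IsFinitelyPresentedMonoid M)
    (hJ : IsFiniteJAbove M) {A : Type*} [Finite A] [Primcodable A] (φ : FreeMonoid A →* M)
    (L : Language A) (hL : RationalIntersectionEmptinessDecidable L) :
    MembershipProblemDecidable {u : M | ∃ w ∈ L, φ (FreeMonoid.ofList w) = u} := by
  classical
  intro n π _
  have := Fintype.ofFinite A
  obtain ⟨m, rules, ρ, hρ, hrules⟩ := hfp.exists_rules
  obtain ⟨σ, hσ⟩ := exists_translation hρ φ
  obtain ⟨τ, hτ⟩ := exists_translation hρ π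
  have hpσ : Primrec fun l : List A => l.flatMap σ :=
    Primrec.list_flatMap Primrec.id ((Primrec.dom_finite σ).comp Primrec.snd)
  have hpτ : Primrec fun w : List (Fin n) => w.flatMap τ :=
    Primrec.list_flatMap Primrec.id ((Primrec.dom_finite τ).comp Primrec.snd)
  refine ComputablePred.computable_iff_re_compl_re'.2 ⟨?_, ?_⟩
  -- A word `l ∈ L` together with a derivation of `φ l = π w` certifies membership.
  · have hcert : ComputablePred fun z : List (Fin n) × List A ×
        List (List (Fin m) × Fin rules.length × List (Fin m)) =>
        z.2.1 ∈ L ∧ z.2.2.foldl (applyInstruction rules) (z.2.1.flatMap σ) = z.1.flatMap τ := by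
      refine ComputablePred.and_computable (ComputablePred.comp_computable hL.computablePred_mem
        (Computable.fst.comp Computable.snd)) (PrimrecPred.computablePred ?_)
      refine Primrec.eq.comp (Primrec.list_foldl
        (h := fun _ x => applyInstruction rules x.1 x.2) (Primrec.snd.comp Primrec.snd)
        (hpσ.comp (Primrec.fst.comp Primrec.snd)) ?_) (hpτ.comp Primrec.fst)
      exact (primrec_applyInstruction rules).comp (Primrec.fst.comp Primrec.snd)
        (Primrec.snd.comp Primrec.snd)
    refine hcert.rePred_exists.of_eq fun w => ?_
    constructor
    · rintro ⟨⟨l, s⟩, hl, hs⟩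
      refine ⟨l, hl, ?_⟩
      rw [← hσ, ← hτ, hrules, reflTransGen_rewritesTo_iff]
      exact ⟨s, hs⟩
    · rintro ⟨l, hl, h⟩
      rw [← hσ, ← hτ, hrules, reflTransGen_rewritesTo_iff] at h
      obtain ⟨s, hs⟩ := h
      exact ⟨(l, s), hl, hs⟩
  -- A table `(k, T)` that respects the relations, together with a state at which `π w` acts
  -- differently from every element of `φ(L)`, certifies non-membership. States are reduced modulo
  -- `k + 1` so that every certificate names one. `C (w, (k, T), i)` recognizes the words over `A`
  -- that act on `i` as `w` does.
  · let C (z : List (Fin n) × (ℕ × List (List ℕ)) × ℕ) : FiniteAutomaton A :=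
      FiniteAutomaton.ofStep Finset.univ.toList (z.2.1.1 + 1)
        (fun p a => (σ a).foldl (tableStep z.2.1) p) (z.2.2 % (z.2.1.1 + 1))
        ((z.1.flatMap τ).foldl (tableStep z.2.1) (z.2.2 % (z.2.1.1 + 1)))
    have hmem : ∀ z l, l ∈ (C z).language ↔
        (l.flatMap σ).foldl (tableStep z.2.1) (z.2.2 % (z.2.1.1 + 1)) =
          (z.1.flatMap τ).foldl (tableStep z.2.1) (z.2.2 % (z.2.1.1 + 1)) := by
      intro z l
      rw [FiniteAutomaton.mem_language_ofStep (by simp)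
        (fun p hp a => foldl_tableStep_lt _ hp _) (Nat.mod_lt _ (Nat.succ_pos _)),
        List.foldl_flatMap (l := l)]
    have hC : Primrec C := by
      have hk : Primrec fun z : List (Fin n) × (ℕ × List (List ℕ)) × ℕ => z.2.1.1 + 1 :=
        Primrec.succ.comp (Primrec.fst.comp (Primrec.fst.comp Primrec.snd))
      have hi : Primrec fun z : List (Fin n) × (ℕ × List (List ℕ)) × ℕ => z.2.2 % (z.2.1.1 + 1) :=
        Primrec.nat_mod.comp (Primrec.snd.comp Primrec.snd) hk
      refine FiniteAutomaton.primrec_ofStep _ hk ?_ hi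
        (primrec_foldl_tableStep (Primrec.fst.comp Primrec.snd) hi (hpτ.comp Primrec.fst))
      exact primrec_foldl_tableStep (Primrec.fst.comp (Primrec.snd.comp Primrec.fst))
        (Primrec.fst.comp Primrec.snd)
        ((Primrec.dom_finite σ).comp (Primrec.snd.comp Primrec.snd))
    have hcert : ComputablePred fun z : List (Fin n) × (ℕ × List (List ℕ)) × ℕ =>
        TableRespects rules z.2.1 ∧ L ⊓ (C z).language = ⊥ :=
      ComputablePred.and_computable
        ((primrecPred_tableRespects rules).comp (Primrec.fst.comp Primrec.snd)).computablePred
        (ComputablePred.comp_computable hL hC.to_comp)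
    refine hcert.rePred_exists.of_eq fun w => ?_
    constructor
    · rintro ⟨c, hc, hempty⟩ ⟨l, hl, h⟩
      rw [← hσ, ← hτ, hrules] at h
      exact hempty.le ⟨hl, (hmem (w, c) l).2 (hc.foldl_eq h (Nat.mod_lt _ (Nat.succ_pos _)))⟩
    · intro hw
      obtain ⟨k, e, he, hmul, hsep⟩ := hJ.exists_separating (π (FreeMonoid.ofList w))
      obtain ⟨T, hT⟩ := exists_table ρ he hmul
      refine ⟨((k, T), e 1), ?_, ?_⟩
      · intro p hp r hr
        obtain ⟨a, ha⟩ := he ⟨p, hp⟩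
        have hr' : ρ (FreeMonoid.ofList r.1) = ρ (FreeMonoid.ofList r.2) :=
          (hrules _ _).2 (.single ⟨[], [], r, hr, by simp⟩)
        have hp' : p = e a := by rw [ha]
        rw [hp', hT, hT, hr']
      · rw [eq_bot_iff]
        rintro l ⟨hl, hl'⟩
        have h := (hmem (w, (k, T), e 1) l).1 hl'
        simp only [Nat.mod_eq_of_lt (e 1).isLt] at h
        rw [hT, hT, one_mul, one_mul, hσ, hτ] at h
        exact hw ⟨l, hl, hsep _ (Fin.ext h)⟩
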